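/- Let $k,m\ge 1$ and identify $M_k(\mathbb{C})\otimes M_m(\mathbb{C})$ with $M_{km}(\mathbb{C})$ via the Kronecker product. The tensor rank of $A\in M_k\otimes M_m$ is the least $n$ such that $A$ is a sum of $n$ nonzero elementary tensors $C\otimes D$ with $C\in M_k$, $D\in M_m$. A separable decomposition of $A$ is an expression $A=\sum_{i=1}^n C_i\otimes D_i$ with all $C_i\in M_k$ and $D_i\in M_m$ positive semidefinite Hermitian; it is minimal if $C_1,\dots,C_n$ are linearly independent and $D_1,\dots,D_n$ are linearly independent. $A$ is separable if it has a separable decomposition. \textbf{Theorem (Minimal separability of tensor rank 2 matrices).} Let $A\in M_k\otimes M_m$ be a positive semidefinite Hermitian matrix of tensor rank $2$. Then $A$ has a minimal separable decomposition, and it has exactly two terms: $A=C_1\otimes D_1+C_2\otimes D_2$ with $C_1,C_2\in M_k$ and $D_1,D_2\in M_m$ positive semidefinite Hermitian, $C_1,C_2$ linearly independent and $D_1,D_2$ linearly independent. In particular, $A$ is separable. -/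

import Mathlib

open scoped TensorProduct Kronecker ComplexOrder

noncomputable section

/-- A tensor has tensor rank `1` if it is a nonzero pure tensor `v ⊗ w`. -/
def IsTensorRankOne {𝕜 V W : Type*} [Field 𝕜] [AddCommGroup V] [Module 𝕜 V]
    [AddCommGroup W] [Module 𝕜 W] (r : V ⊗[𝕜] W) : Prop :=
  r ≠ 0 ∧ ∃ (v : V) (w : W), r = v ⊗ₜ[𝕜] w

/-- The tensor rank of `r`: the minimal number of tensors of tensor rank `1` whose sum is `r`.
(The set of such numbers is never empty, and `tensorRank 0 = 0`.) -/
def tensorRank {𝕜 V W : Type*} [Field 𝕜] [AddCommGroup V] [Module 𝕜 V]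
    [AddCommGroup W] [Module 𝕜 W] (r : V ⊗[𝕜] W) : ℕ :=
  sInf {n : ℕ | ∃ t : Fin n → V ⊗[𝕜] W, (∀ i, IsTensorRankOne (t i)) ∧ r = ∑ i, t i}

/-- The tensor rank of `A ∈ M_k ⊗ M_m`, where `M_k ⊗ M_m` is identified with `M_{km}` via the
Kronecker product (`kroneckerLinearEquiv` sends `C ⊗ₜ D` to `C ⊗ₖ D`). -/
def matrixTensorRank {k m : ℕ} (A : Matrix (Fin k × Fin m) (Fin k × Fin m) ℂ) : ℕ :=
  tensorRank ((kroneckerLinearEquiv (Fin k) (Fin k) (Fin m) (Fin m) ℂ).symm A)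

/-- `A = ∑ i, C i ⊗ D i` is a decomposition of `A` in `M_k ⊗ M_m` with `n` terms. -/
def IsDecomposition {k m n : ℕ} (A : Matrix (Fin k × Fin m) (Fin k × Fin m) ℂ)
    (C : Fin n → Matrix (Fin k) (Fin k) ℂ) (D : Fin n → Matrix (Fin m) (Fin m) ℂ) : Prop :=
  A = ∑ i, C i ⊗ₖ D i

/-- A separable decomposition: all `C i` and `D i` are positive semidefinite Hermitian
(`Matrix.PosSemidef` includes Hermitian). -/
def IsSeparableDecomposition {k m n : ℕ} (A : Matrix (Fin k × Fin m) (Fin k × Fin m) ℂ)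
    (C : Fin n → Matrix (Fin k) (Fin k) ℂ) (D : Fin n → Matrix (Fin m) (Fin m) ℂ) : Prop :=
  IsDecomposition A C D ∧ ∀ i, (C i).PosSemidef ∧ (D i).PosSemidef

/-- A minimal decomposition: the `C i` are linearly independent and so are the `D i`. -/
def IsMinimalDecomposition {k m n : ℕ} (A : Matrix (Fin k × Fin m) (Fin k × Fin m) ℂ)
    (C : Fin n → Matrix (Fin k) (Fin k) ℂ) (D : Fin n → Matrix (Fin m) (Fin m) ℂ) : Prop :=
  IsDecomposition A C D ∧ LinearIndependent ℂ C ∧ LinearIndependent ℂ D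

/-- `A` is separable if it has a separable decomposition (with any finite number of terms). -/
def IsSeparableMatrix {k m : ℕ} (A : Matrix (Fin k × Fin m) (Fin k × Fin m) ℂ) : Prop :=
  ∃ (n : ℕ) (C : Fin n → Matrix (Fin k) (Fin k) ℂ) (D : Fin n → Matrix (Fin m) (Fin m) ℂ),
    IsSeparableDecomposition A C D

end

/-!
Write `A = ∑ Cᵢ ⊗ Dᵢ` with two terms. For every vector `w`, the matrix `∑ (w* Dᵢ w) Cᵢ`, a
compression of `A`, is positive semidefinite. A complex matrix is determined by its quadratic form,
so these compressions span the plane of the `Cᵢ`, which is therefore spanned by positive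
semidefinite matrices `X₀`, `X₁`. The positive semidefinite cone is closed and salient, so it meets
the real span of `X₀`, `X₁` in a planar cone with exactly two extreme rays; let them replace the
`Cᵢ`. Nonnegativity of the compressions now says that the coordinates `w* Dᵢ w` with respect to the
two rays are nonnegative for all `w`, that is, that the new `Dᵢ` are positive semidefinite.
-/

open Matrix Module Submodule Set Filter Topology

section TensorRank

theorem exists_sum_tmul_eq_of_forall_mem_span {R V W ι κ : Type*} [CommSemiring R]
    [AddCommMonoid V] [Module R V] [AddCommMonoid W] [Module R W] [Fintype ι] [Fintype κ]
    {v : ι → V} {x : κ → V} (h : ∀ i, v i ∈ span R (range x)) (w : ι → W) :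
    ∃ w' : κ → W, ∑ i, v i ⊗ₜ[R] w i = ∑ j, x j ⊗ₜ[R] w' j := by
  simp only [mem_span_range_iff_exists_fun] at h
  choose c hc using h
  refine ⟨fun j => ∑ i, c i j • w i, ?_⟩
  simp only [← hc, TensorProduct.sum_tmul, TensorProduct.tmul_sum, TensorProduct.smul_tmul]
  exact Finset.sum_comm

variable {𝕜 V W ι : Type*} [Field 𝕜] [AddCommGroup V] [Module 𝕜 V] [AddCommGroup W] [Module 𝕜 W]
  [Fintype ι]

theorem exists_isTensorRankOne_sum_eq_sum_tmul (v : ι → V) (w : ι → W) :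
    ∃ n ≤ Fintype.card ι, ∃ t : Fin n → V ⊗[𝕜] W,
      (∀ i, IsTensorRankOne (t i)) ∧ ∑ i, v i ⊗ₜ[𝕜] w i = ∑ i, t i := by
  classical
  let s : Finset ι := {i | v i ⊗ₜ[𝕜] w i ≠ 0}
  refine ⟨s.card, s.card_le_univ, fun j => v (s.equivFin.symm j) ⊗ₜ w (s.equivFin.symm j),
    fun j => ⟨(Finset.mem_filter.1 (s.equivFin.symm j).2).2, _, _, rfl⟩, ?_⟩
  rw [s.equivFin.symm.sum_comp fun i : s => v i ⊗ₜ[𝕜] w i,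
    Finset.sum_coe_sort s fun i => v i ⊗ₜ[𝕜] w i, Finset.sum_filter_ne_zero]

theorem tensorRank_sum_tmul_le_card (v : ι → V) (w : ι → W) :
    tensorRank (∑ i, v i ⊗ₜ[𝕜] w i) ≤ Fintype.card ι :=
  let ⟨_, hn, ht⟩ := exists_isTensorRankOne_sum_eq_sum_tmul v w
  (Nat.sInf_le ht).trans hn

theorem exists_eq_sum_tmul_of_tensorRank_eq {r : V ⊗[𝕜] W} {n : ℕ} (h : tensorRank r = n) :
    ∃ (v : Fin n → V) (w : Fin n → W), r = ∑ i, v i ⊗ₜ[𝕜] w i := by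
  obtain ⟨_, v₀, w₀, hr⟩ := TensorProduct.exists_sum_tmul_eq r
  obtain ⟨m, -, hm⟩ := exists_isTensorRankOne_sum_eq_sum_tmul (𝕜 := 𝕜) v₀ w₀
  rw [← hr] at hm
  obtain ⟨t, ht, hrt⟩ : n ∈ {n : ℕ | ∃ t : Fin n → V ⊗[𝕜] W,
      (∀ i, IsTensorRankOne (t i)) ∧ r = ∑ i, t i} := h ▸ Nat.sInf_mem ⟨m, hm⟩
  choose v w hvw using fun i => (ht i).2
  exact ⟨v, w, hrt.trans (Fintype.sum_congr _ _ hvw)⟩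

theorem tensorRank_comm_le (r : V ⊗[𝕜] W) :
    tensorRank (TensorProduct.comm 𝕜 V W r) ≤ tensorRank r := by
  obtain ⟨v, w, hr⟩ := exists_eq_sum_tmul_of_tensorRank_eq (rfl : tensorRank r = _)
  calc tensorRank (TensorProduct.comm 𝕜 V W r) = tensorRank (∑ i, w i ⊗ₜ[𝕜] v i) := by
        conv_lhs => rw [hr, map_sum]
        simp only [TensorProduct.comm_tmul]
    _ ≤ tensorRank r := by simpa using tensorRank_sum_tmul_le_card w v

theorem tensorRank_sum_tmul_le_finrank_span (v : ι → V) (w : ι → W) :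
    tensorRank (∑ i, v i ⊗ₜ[𝕜] w i) ≤ finrank 𝕜 (span 𝕜 (range v)) := by
  have := FiniteDimensional.span_of_finite 𝕜 (finite_range v)
  obtain ⟨x, -, hx, -⟩ := exists_fun_fin_finrank_span_eq 𝕜 (range v)
  obtain ⟨w', hw'⟩ := exists_sum_tmul_eq_of_forall_mem_span
    (fun i => hx ▸ subset_span (mem_range_self i)) w
  simpa [hw'] using tensorRank_sum_tmul_le_card (𝕜 := 𝕜) x w'

theorem linearIndependent_left_of_card_le_tensorRank {v : ι → V} {w : ι → W}
    (h : Fintype.card ι ≤ tensorRank (∑ i, v i ⊗ₜ[𝕜] w i)) : LinearIndependent 𝕜 v :=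
  linearIndependent_iff_card_le_finrank_span.2 (h.trans (tensorRank_sum_tmul_le_finrank_span v w))

theorem linearIndependent_right_of_card_le_tensorRank {v : ι → V} {w : ι → W}
    (h : Fintype.card ι ≤ tensorRank (∑ i, v i ⊗ₜ[𝕜] w i)) : LinearIndependent 𝕜 w := by
  have hcomm : tensorRank (∑ i, v i ⊗ₜ[𝕜] w i) ≤ tensorRank (∑ i, w i ⊗ₜ[𝕜] v i) := by
    simpa only [map_sum, TensorProduct.comm_tmul] using tensorRank_comm_le (∑ i, w i ⊗ₜ[𝕜] v i)
  exact linearIndependent_left_of_card_le_tensorRank (h.trans hcomm)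

end TensorRank

section OrderedSpace

variable {E : Type*} [AddCommGroup E] [Module ℝ E] [PartialOrder E] [IsOrderedAddMonoid E]
  [IsOrderedModule ℝ E]

theorem nonneg_of_nonneg_smul_add_smul {c d : E} (hd : 0 ≤ d) (h : ∀ t : ℝ, t • c ≤ d → t ≤ 0)
    {a b : ℝ} (hab : 0 ≤ a • c + b • d) : 0 ≤ a := by
  have hz : 0 < |b| + 1 := by positivity
  have hle : (-a) • c ≤ (|b| + 1) • d := calc
    (-a) • c ≤ (-a) • c + (a • c + b • d) := le_add_of_nonneg_right hab
    _ = b • d := by module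
    _ ≤ (|b| + 1) • d := smul_le_smul_of_nonneg_right (by linarith [le_abs_self b]) hd
  rw [← inv_smul_le_iff_of_pos hz, smul_smul] at hle
  simpa [inv_mul_eq_div, div_nonneg_iff, hz.le, hz.not_ge] using h _ hle

theorem nonpos_of_smul_sub_smul_le {c y : E} (h : ∀ t : ℝ, t • y ≤ c → t ≤ 0) {r t : ℝ}
    (hr : 0 ≤ r) (ht : t • (y - r • c) ≤ c) : t ≤ 0 := by
  by_contra! ht₀
  have hz : 0 < 1 + t * r := by positivity
  have hle : t • y ≤ (1 + t * r) • c := calc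
    t • y = t • (y - r • c) + (t * r) • c := by module
    _ ≤ c + (t * r) • c := by gcongr
    _ = (1 + t * r) • c := by module
  rw [← inv_smul_le_iff_of_pos hz, smul_smul] at hle
  exact (h _ hle).not_gt (by positivity)

variable [TopologicalSpace E] [ContinuousSMul ℝ E] [OrderClosedTopology E]

theorem bddAbove_setOf_smul_le {x y : E} (hx : 0 ≤ x) (hy : 0 < y) :
    BddAbove {t : ℝ | t • y ≤ x} := by
  by_contra hb
  have hle (ε : ℝ) (hε : 0 < ε) : y ≤ ε • x := by
    obtain ⟨t, ht, hεt⟩ := not_bddAbove_iff.1 hb ε⁻¹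
    have ht₀ : 0 < t := (inv_pos.2 hε).trans hεt
    calc y ≤ t⁻¹ • x := (le_inv_smul_iff_of_pos ht₀).2 ht
      _ ≤ ε • x := smul_le_smul_of_nonneg_right (inv_lt_of_inv_lt₀ hε hεt).le hx
  have hlim : Tendsto (fun ε : ℝ => ε • x) (𝓝[>] 0) (𝓝 0) :=
    (Continuous.tendsto' (by fun_prop) 0 0 (zero_smul ℝ x)).mono_left nhdsWithin_le_nhds
  exact hy.not_ge (ge_of_tendsto hlim (eventually_mem_nhdsWithin.mono hle))

theorem exists_nonneg_sub_smul_maximal {x y : E} (hx : 0 ≤ x) (hy : 0 < y) :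
    ∃ s : ℝ, 0 ≤ s ∧ 0 ≤ x - s • y ∧ ∀ t : ℝ, t • y ≤ x - s • y → t ≤ 0 := by
  have hzero : (0 : ℝ) ∈ {t : ℝ | t • y ≤ x} := by simpa using hx
  have hclosed : IsClosed {t : ℝ | t • y ≤ x} := isClosed_le (by fun_prop) continuous_const
  obtain ⟨hmem, hmax⟩ := hclosed.isGreatest_csSup ⟨0, hzero⟩ (bddAbove_setOf_smul_le hx hy)
  refine ⟨_, hmax hzero, sub_nonneg.2 hmem, fun t ht => ?_⟩
  have : (t + sSup {t : ℝ | t • y ≤ x}) • y ≤ x := by rwa [add_smul, ← le_sub_iff_add_le]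
  simpa using hmax this

theorem exists_nonneg_pair_generating {x : Fin 2 → E} (hx : ∀ i, 0 ≤ x i)
    (hli : LinearIndependent ℝ x) :
    ∃ c : Fin 2 → E, (∀ i, 0 ≤ c i) ∧ (∀ i, x i ∈ span ℝ (range c)) ∧
      ∀ a : Fin 2 → ℝ, 0 ≤ ∑ i, a i • c i → ∀ i, 0 ≤ a i := by
  obtain ⟨s, -, hc, hsmax⟩ :=
    exists_nonneg_sub_smul_maximal (hx 0) ((hx 1).lt_of_ne' (hli.ne_zero 1))
  set c := x 0 - s • x 1 with hc_def
  have hc₀ : c ≠ 0 := sub_ne_zero.2 ((linearIndependent_fin2.1 hli).2 s).symm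
  obtain ⟨r, hr, hd, hrmax⟩ := exists_nonneg_sub_smul_maximal (hx 1) (hc.lt_of_ne' hc₀)
  set d := x 1 - r • c with hd_def
  have hx₁ : x 1 = r • c + (1 : ℝ) • d := by rw [hd_def]; module
  have hx₀ : x 0 = (1 + s * r) • c + s • d := by rw [hd_def, hc_def]; module
  refine ⟨![c, d], Fin.forall_fin_two.2 ⟨hc, hd⟩, ?_, fun a ha => ?_⟩
  · simp only [range_cons, range_empty, union_empty, singleton_union, mem_span_pair]
    exact Fin.forall_fin_two.2 ⟨⟨_, _, hx₀.symm⟩, ⟨_, _, hx₁.symm⟩⟩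
  · simp only [Fin.sum_univ_two, cons_val_zero, cons_val_one] at ha
    exact Fin.forall_fin_two.2 ⟨nonneg_of_nonneg_smul_add_smul hd hrmax ha,
      nonneg_of_nonneg_smul_add_smul hc
        (fun t ht => nonpos_of_smul_sub_smul_le hsmax hr ht) (add_comm (a 0 • c) _ ▸ ha)⟩

end OrderedSpace

section Matrix

variable {p q ι : Type*} [Fintype ι]

/-- The vector functional `D ↦ w* D w` on `M_q`. -/
def vectorFunctional {R : Type*} [CommSemiring R] [StarRing R] [Fintype q] (w : q → R) :
    Matrix q q R →ₗ[R] R where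
  toFun D := star w ⬝ᵥ D *ᵥ w
  map_add' D D' := by rw [add_mulVec, dotProduct_add]
  map_smul' a D := by rw [smul_mulVec, dotProduct_smul, RingHom.id_apply]

theorem conjTranspose_one_kronecker_mul_kronecker_mul {R : Type*} [CommSemiring R] [StarRing R]
    [Fintype p] [Fintype q] [DecidableEq p] (C : Matrix p p R) (D : Matrix q q R) (w : q → R) :
    ((1 : Matrix p p R) ⊗ₖ replicateCol Unit w)ᴴ * (C ⊗ₖ D) *
      ((1 : Matrix p p R) ⊗ₖ replicateCol Unit w) =
      C ⊗ₖ of fun _ _ => vectorFunctional w D := by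
  rw [conjTranspose_kronecker, ← mul_kronecker_mul, ← mul_kronecker_mul, conjTranspose_one,
    one_mul, mul_one, Matrix.mul_assoc]
  rfl

theorem posSemidef_sum_vectorFunctional_smul {R : Type*} [CommRing R] [PartialOrder R]
    [StarRing R] [Finite p] [Fintype q] {C : ι → Matrix p p R} {D : ι → Matrix q q R}
    (h : (∑ i, C i ⊗ₖ D i).PosSemidef) (w : q → R) :
    (∑ i, vectorFunctional w (D i) • C i).PosSemidef := by
  classical
  cases nonempty_fintype p
  convert (h.conjTranspose_mul_mul_same
    ((1 : Matrix p p R) ⊗ₖ replicateCol Unit w)).submatrix (fun i => (i, ()))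
  simp only [Matrix.mul_sum, Matrix.sum_mul, conjTranspose_one_kronecker_mul_kronecker_mul]
  ext i j
  simp [Matrix.sum_apply, mul_comm]

theorem posSemidef_of_forall_vectorFunctional_nonneg [Fintype q] {D : Matrix q q ℂ}
    (h : ∀ w, 0 ≤ vectorFunctional w D) : D.PosSemidef := by
  classical
  rw [← isPositive_toEuclideanLin_iff, LinearMap.isPositive_iff_complex]
  intro x
  have hinner : inner ℂ (toEuclideanLin D x) x = star (vectorFunctional x.ofLp D) := by
    rw [← inner_conj_symm, EuclideanSpace.inner_eq_star_dotProduct, dotProduct_comm]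
    rfl
  have hnonneg : 0 ≤ inner ℂ (toEuclideanLin D x) x := hinner ▸ star_nonneg_iff.2 (h _)
  exact ⟨(Complex.eq_re_of_ofReal_le hnonneg).symm, (Complex.nonneg_iff.1 hnonneg).1⟩

theorem eq_zero_of_forall_vectorFunctional_eq_zero [Fintype q] {D : Matrix q q ℂ}
    (h : ∀ w, vectorFunctional w D = 0) : D = 0 := by
  open scoped MatrixOrder in
  refine le_antisymm ?_ ?_
  · rw [← neg_nonneg]
    exact (posSemidef_of_forall_vectorFunctional_nonneg fun w => by simp [h]).nonneg
  · exact (posSemidef_of_forall_vectorFunctional_nonneg fun w => (h w).ge).nonneg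

theorem span_range_sum_vectorFunctional_smul {V : Type*} [AddCommGroup V] [Module ℂ V]
    [Fintype q] (v : ι → V) {D : ι → Matrix q q ℂ} (hD : LinearIndependent ℂ D) :
    span ℂ (range fun w => ∑ i, vectorFunctional w (D i) • v i) = span ℂ (range v) := by
  refine le_antisymm (span_le.2 ?_) (span_le.2 ?_)
  · rintro _ ⟨w, rfl⟩
    exact sum_mem fun i _ => smul_mem _ _ (subset_span (mem_range_self i))
  · rintro _ ⟨j, rfl⟩
    by_contra hj
    obtain ⟨f, hfj, hf⟩ := exists_le_ker_of_notMem hj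
    have hsum : ∑ i, f (v i) • D i = 0 := eq_zero_of_forall_vectorFunctional_eq_zero fun w => by
      have := hf (subset_span (mem_range_self w))
      simpa [mul_comm] using this
    exact hfj (Fintype.linearIndependent_iff.1 hD _ hsum j)

theorem isSelfAdjoint_of_isSelfAdjoint_sum_smul {R V : Type*} [Semiring R] [StarRing R]
    [AddCommMonoid V] [StarAddMonoid V] [Module R V] [StarModule R V] {v : ι → V} {a : ι → R}
    (hv : LinearIndependent R v) (hsa : ∀ i, IsSelfAdjoint (v i))
    (h : IsSelfAdjoint (∑ i, a i • v i)) (i : ι) : IsSelfAdjoint (a i) := by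
  have hsum : ∑ i, star (a i) • v i = ∑ i, a i • v i := by
    simpa [(hsa _).star_eq] using h.star_eq
  exact Fintype.linearIndependent_iffₛ.1 hv _ _ hsum i

theorem posSemidef_right_of_posSemidef_sum_kronecker [Finite p] [Finite q]
    {C : ι → Matrix p p ℂ} {D : ι → Matrix q q ℂ} (hCD : (∑ i, C i ⊗ₖ D i).PosSemidef)
    (hC : ∀ i, (C i).PosSemidef) (hli : LinearIndependent ℂ C)
    (hcone : ∀ a : ι → ℝ, (∑ i, a i • C i).PosSemidef → ∀ i, 0 ≤ a i) (i : ι) :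
    (D i).PosSemidef := by
  cases nonempty_fintype q
  refine posSemidef_of_forall_vectorFunctional_nonneg fun w => ?_
  have hw := posSemidef_sum_vectorFunctional_smul hCD w
  have hreal (j : ι) : ((vectorFunctional w (D j)).re : ℂ) = vectorFunctional w (D j) :=
    Complex.conj_eq_iff_re.1 (isSelfAdjoint_of_isSelfAdjoint_sum_smul hli
      (fun j => (hC j).isHermitian) hw.isHermitian j)
  rw [← hreal i, Complex.zero_le_real]
  refine hcone (fun j => (vectorFunctional w (D j)).re) ?_ i
  simpa only [← Complex.coe_smul, hreal] using hw

theorem exists_posSemidef_span_eq [Finite p] [Finite q] {C : ι → Matrix p p ℂ}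
    {D : ι → Matrix q q ℂ}
    (hCD : (∑ i, C i ⊗ₖ D i).PosSemidef) (hC : LinearIndependent ℂ C)
    (hD : LinearIndependent ℂ D) :
    ∃ X : ι → Matrix p p ℂ, (∀ i, (X i).PosSemidef) ∧
      span ℂ (range X) = span ℂ (range C) ∧ LinearIndependent ℂ X := by
  cases nonempty_fintype q
  let S : Set (Matrix p p ℂ) := range fun w => ∑ i, vectorFunctional w (D i) • C i
  have hspan : span ℂ S = span ℂ (range C) := span_range_sum_vectorFunctional_smul C hD
  have hfin : Fintype.card ι = finrank ℂ (span ℂ S) := by rw [hspan, finrank_span_eq_card hC]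
  obtain ⟨X, hX, hXspan, hli⟩ := exists_fun_fin_finrank_span_eq ℂ S
  let e : ι ≃ Fin (finrank ℂ (span ℂ S)) := Fintype.equivFinOfCardEq hfin
  have hXpos (j) : (X j).PosSemidef := by
    obtain ⟨w, hw⟩ := hX j
    exact hw ▸ posSemidef_sum_vectorFunctional_smul hCD w
  exact ⟨X ∘ e, fun i => hXpos (e i), by rw [e.surjective.range_comp, hXspan, hspan],
    hli.comp e e.injective⟩

theorem exists_posSemidef_pair_generating [Finite p] {X : Fin 2 → Matrix p p ℂ}
    (hX : ∀ i, (X i).PosSemidef) (hli : LinearIndependent ℂ X) :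
    ∃ C : Fin 2 → Matrix p p ℂ, (∀ i, (C i).PosSemidef) ∧ (∀ i, X i ∈ span ℂ (range C)) ∧
      ∀ a : Fin 2 → ℝ, (∑ i, a i • C i).PosSemidef → ∀ i, 0 ≤ a i := by
  classical
  cases nonempty_fintype p
  -- The C⋆-algebra structure is needed only to know that the Loewner order is closed.
  open scoped MatrixOrder Matrix.Norms.L2Operator in
  obtain ⟨C, hC, hspan, hcone⟩ := exists_nonneg_pair_generating (fun i => (hX i).nonneg)
    (hli.restrict_scalars' ℝ)
  exact ⟨C, fun i => (hC i).posSemidef, fun i => span_le_restrictScalars ℝ ℂ _ (hspan i),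
    fun a ha => hcone a ha.nonneg⟩

theorem kroneckerLinearEquiv_sum_tmul {R l m n o : Type*} [CommSemiring R] [Fintype l] [Fintype m]
    [Fintype n] [Fintype o] [DecidableEq l] [DecidableEq m] [DecidableEq n] [DecidableEq o]
    (C : ι → Matrix l m R) (D : ι → Matrix n o R) :
    kroneckerLinearEquiv l m n o R (∑ i, C i ⊗ₜ D i) = ∑ i, C i ⊗ₖ D i := by
  simp only [map_sum, kroneckerLinearEquiv_tmul]

end Matrix

theorem mainTheorem5_general {p q : Type*} [Fintype p] [Fintype q] [DecidableEq p] [DecidableEq q]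
    {A : Matrix (p × q) (p × q) ℂ} (hA : A.PosSemidef)
    (hrank : tensorRank ((kroneckerLinearEquiv p p q q ℂ).symm A) = 2) :
    ∃ (C : Fin 2 → Matrix p p ℂ) (D : Fin 2 → Matrix q q ℂ),
      A = ∑ i, C i ⊗ₖ D i ∧ (∀ i, (C i).PosSemidef ∧ (D i).PosSemidef) ∧
      LinearIndependent ℂ C ∧ LinearIndependent ℂ D := by
  obtain ⟨t, rfl⟩ := (kroneckerLinearEquiv p p q q ℂ).surjective A
  rw [LinearEquiv.symm_apply_apply] at hrank
  obtain ⟨C₀, D₀, rfl⟩ := exists_eq_sum_tmul_of_tensorRank_eq hrank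
  rw [kroneckerLinearEquiv_sum_tmul] at hA
  obtain ⟨X, hX, hspan, hXli⟩ := exists_posSemidef_span_eq hA
    (linearIndependent_left_of_card_le_tensorRank hrank.ge)
    (linearIndependent_right_of_card_le_tensorRank hrank.ge)
  obtain ⟨C, hC, hXC, hcone⟩ := exists_posSemidef_pair_generating hX hXli
  have hC₀ (i) : C₀ i ∈ span ℂ (range C) :=
    span_le.2 (range_subset_iff.2 hXC) (hspan ▸ subset_span (mem_range_self i))
  obtain ⟨D, hCD⟩ := exists_sum_tmul_eq_of_forall_mem_span hC₀ D₀
  rw [hCD] at hrank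
  rw [← kroneckerLinearEquiv_sum_tmul, hCD, kroneckerLinearEquiv_sum_tmul] at hA
  have hCli : LinearIndependent ℂ C := linearIndependent_left_of_card_le_tensorRank hrank.ge
  exact ⟨C, D, hCD ▸ kroneckerLinearEquiv_sum_tmul C D,
    fun i => ⟨hC i, posSemidef_right_of_posSemidef_sum_kronecker hA hC hCli hcone i⟩,
    hCli, linearIndependent_right_of_card_le_tensorRank hrank.ge⟩

theorem mainTheorem5 (k m : ℕ) (A : Matrix (Fin k × Fin m) (Fin k × Fin m) ℂ)
    (hA : A.PosSemidef) (hrank : matrixTensorRank A = 2) :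
    (∃ (C : Fin 2 → Matrix (Fin k) (Fin k) ℂ) (D : Fin 2 → Matrix (Fin m) (Fin m) ℂ),
      IsSeparableDecomposition A C D ∧ IsMinimalDecomposition A C D) ∧
    IsSeparableMatrix A := by
  obtain ⟨C, D, hCD, hpos, hC, hD⟩ := mainTheorem5_general hA hrank
  exact ⟨⟨C, D, ⟨hCD, hpos⟩, hCD, hC, hD⟩, 2, C, D, hCD, hpos⟩
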